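/- Consider $n\ge 1$ anonymous, homogeneous, oblivious robots on the nodes of the infinite grid graph (the Cartesian product of two infinite paths, embedded in the plane with vertex set $\mathbb Z^2$), together with a finite set $M$ of meeting nodes. Each robot has its own local coordinate system along the grid lines, with its current position as origin; there is no agreement on orientation or chirality. Robots work in Look-Compute-Move cycles under a fair asynchronous scheduler. In the Look phase a robot sees, in its local coordinates, all meeting nodes and the exact number of robots on every node. In the Compute phase a deterministic algorithm, common to all robots, decides from this snapshot alone to stay or to move to an adjacent node. The move is instantaneous and happens at a later time chosen by the scheduler. Initially no move is pending, and in an initial configuration $C(0)$ the robots are on pairwise distinct nodes. A Weber node of a configuration is a meeting node that minimizes, among all meeting nodes, the sum of the grid distances from all robots. Let $W$ be the set of Weber nodes of $C(0)$. Gathering over Weber nodes can be solved from $C(0)$ if there is an algorithm that, for all choices of the local coordinate systems and in every fair asynchronous execution from $C(0)$, brings all robots within finite time to one node $m\in W$, where they remain. Let $\mathcal U$ be the set of initial configurations from which gathering over Weber nodes cannot be solved. A symmetry of $M$ is an automorphism of the grid that maps $M$ onto itself; a symmetry of a configuration is one that moreover preserves the number of robots on every node. The symmetries that matter are reflections in a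 line $l$ of the plane and rotations by $90^\circ$ or $180^\circ$ about a point $c$ of the plane. Define the following classes of initial configurations. * $\mathcal I_3^{b3}$: $|W|\ge 2$, $M$ has a unique line of symmetry $l$, the configuration is symmetric with respect to $l$, and no Weber node and no robot lies on $l$. * $\mathcal I_3^{b4}$: $|W|\ge 2$, $M$ has a unique line of symmetry $l$, the configuration is symmetric with respect to $l$, and no meeting node and no robot lies on $l$. * $\mathcal I_4^{b3}$: $|W|\ge 2$, $M$ has a rotational symmetry with centre $c$, the configuration has a rotational symmetry with centre $c$, and $c$ is neither a meeting node nor the position of a robot. Then: 1. If $C(0)\in \mathcal I_3^{b3}\cup\mathcal I_4^{b3}$, then gathering over Weber nodes cannot be solved from $C(0)$, that is, $\mathcal I_3^{b3}\cup\mathcal I_4^{b3}\subseteq\mathcal U$. 2. Likewise $\mathcal I_3^{b4}\subseteq\mathcal U$. 3. Consequently $\mathcal U$ includes all initial configurations that admit a single line of symmetry $l$ with no robot and no Weber node on $l$, and all initial configurations that admit a rotational symmetry with centre $c$ where $c$ is neither a meeting node nor the position of a robot. -/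

import Mathlib

noncomputable section

/-- The nodes of the infinite grid. -/
abbrev Node : Type := ℤ × ℤ

/-- The infinite grid: the Cartesian product of two copies of the infinite path on `ℤ`. -/
def gridGraph : SimpleGraph Node := SimpleGraph.boxProd (SimpleGraph.hasse ℤ) (SimpleGraph.hasse ℤ)

/-- Automorphisms of the grid graph. -/
abbrev GridAut : Type := gridGraph ≃g gridGraph

/-! ### Symmetries -/

/-- The embedding of the grid in the Cartesian plane (the plane is `ℂ`). -/
def toPlane (v : Node) : ℂ := ⟨(v.1 : ℝ), (v.2 : ℝ)⟩

/-- `φ` is the restriction to the grid of the reflection of the plane in the line `l`. -/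
def IsReflectionIn (φ : GridAut) (l : AffineSubspace ℝ ℂ) : Prop :=
  Module.finrank ℝ l.direction = 1 ∧
    ∃ _ : Nonempty l, ∀ v, toPlane (φ v) = EuclideanGeometry.reflection l (toPlane v)

/-- `φ` is the restriction to the grid of the rotation of the plane about `c` by `90°` or `180°`. -/
def IsRotationAbout (φ : GridAut) (c : ℂ) : Prop :=
  ∃ ω : ℂ, (ω = Complex.I ∨ ω = -1) ∧ ∀ v, toPlane (φ v) = c + ω * (toPlane v - c)

/-- The automorphism `φ` of the grid preserves the set `M` of nodes. -/
def PreservesNodes (φ : GridAut) (M : Finset Node) : Prop := ∀ v, φ v ∈ M ↔ v ∈ M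

/-- `l` is a line of symmetry of the set `M` of nodes. -/
def IsSymmetryLine (M : Finset Node) (l : AffineSubspace ℝ ℂ) : Prop :=
  ∃ φ : GridAut, IsReflectionIn φ l ∧ PreservesNodes φ M

/-- The set `M` of nodes admits a rotational symmetry with centre `c`. -/
def IsRotationCentre (M : Finset Node) (c : ℂ) : Prop :=
  ∃ φ : GridAut, IsRotationAbout φ c ∧ PreservesNodes φ M

/-! ### Configurations -/

/-- A configuration of `n` robots (several robots may share a node) and a finite set of
meeting nodes. -/
structure Configuration (n : ℕ) where
  /-- the position of each robot -/
  robots : Fin n → Node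
  /-- the set of meeting nodes -/
  meeting : Finset Node

namespace Configuration

variable {n : ℕ}

/-- The number of robots on the node `v`. -/
def count (C : Configuration n) (v : Node) : ℕ := (Finset.univ.filter fun i => C.robots i = v).card

/-- In an initial configuration the robots are on distinct nodes. -/
def IsInitial (C : Configuration n) : Prop := Function.Injective C.robots

/-- The consistency of a node: the sum of its grid distances from all the robots. -/
def consistency (C : Configuration n) (m : Node) : ℕ := ∑ i, gridGraph.dist (C.robots i) m

/-- The Weber nodes: the meeting nodes of minimum consistency. -/
def weberNodes (C : Configuration n) : Finset Node :=
  C.meeting.filter fun m => ∀ m' ∈ C.meeting, C.consistency m ≤ C.consistency m'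

/-- An automorphism of a configuration preserves the meeting nodes and the number of robots
on every node. -/
def IsAutomorphism (C : Configuration n) (φ : GridAut) : Prop :=
  PreservesNodes φ C.meeting ∧ ∀ v, C.count (φ v) = C.count v

/-- The configuration is symmetric with respect to the line `l`. -/
def IsSymmetricIn (C : Configuration n) (l : AffineSubspace ℝ ℂ) : Prop :=
  ∃ φ : GridAut, IsReflectionIn φ l ∧ C.IsAutomorphism φ

/-- The configuration has a rotational symmetry with centre `c`. -/
def IsRotationallySymmetric (C : Configuration n) (c : ℂ) : Prop :=
  ∃ φ : GridAut, IsRotationAbout φ c ∧ C.IsAutomorphism φ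

/-- No robot lies on the set `s` of points of the plane. -/
def NoRobotOn (C : Configuration n) (s : Set ℂ) : Prop := ∀ i, toPlane (C.robots i) ∉ s

/-- No meeting node lies on `s`. -/
def NoMeetingNodeOn (C : Configuration n) (s : Set ℂ) : Prop := ∀ m ∈ C.meeting, toPlane m ∉ s

/-- No Weber node lies on `s`. -/
def NoWeberNodeOn (C : Configuration n) (s : Set ℂ) : Prop := ∀ m ∈ C.weberNodes, toPlane m ∉ s

end Configuration

/-! ### Classes of initial configurations -/

/-- `I₃ᵇ` with line of symmetry `l`: there are at least two Weber nodes, `l` is the unique line of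
symmetry of the meeting nodes, and the whole configuration is symmetric in `l`. -/
def InI3b {n : ℕ} (C : Configuration n) (l : AffineSubspace ℝ ℂ) : Prop :=
  C.IsInitial ∧ 2 ≤ C.weberNodes.card ∧
    (IsSymmetryLine C.meeting l ∧ ∀ l', IsSymmetryLine C.meeting l' → l' = l) ∧
    C.IsSymmetricIn l

/-- `I₃ᵇ³`: no robot and no Weber node on the line of symmetry. -/
def classI3b3 (n : ℕ) : Set (Configuration n) :=
  {C | ∃ l, InI3b C l ∧ C.NoWeberNodeOn l ∧ C.NoRobotOn l}

/-- `I₃ᵇ⁴`: no robot and no meeting node on the line of symmetry. -/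
def classI3b4 (n : ℕ) : Set (Configuration n) :=
  {C | ∃ l, InI3b C l ∧ C.NoMeetingNodeOn l ∧ C.NoRobotOn l}

/-- `I₄ᵇ` with centre `c`: there are at least two Weber nodes, and the meeting nodes as well as the
whole configuration have a rotational symmetry with centre `c`. -/
def InI4b {n : ℕ} (C : Configuration n) (c : ℂ) : Prop :=
  C.IsInitial ∧ 2 ≤ C.weberNodes.card ∧ IsRotationCentre C.meeting c ∧ C.IsRotationallySymmetric c

/-- `I₄ᵇ³`: no robot and no meeting node at the centre. -/
def classI4b3 (n : ℕ) : Set (Configuration n) :=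
  {C | ∃ c, InI4b C c ∧ C.NoMeetingNodeOn {c} ∧ C.NoRobotOn {c}}

/-- The initial configurations that admit a single line of symmetry `l`, with no robot and no Weber
node on `l`. -/
def singleLineFamily (n : ℕ) : Set (Configuration n) :=
  {C | C.IsInitial ∧ ∃ l, (C.IsSymmetricIn l ∧ ∀ l', C.IsSymmetricIn l' → l' = l) ∧
    C.NoRobotOn l ∧ C.NoWeberNodeOn l}

/-- The initial configurations that admit a rotational symmetry, with no robot and no meeting node
at its centre `c`. -/
def rotationalFamily (n : ℕ) : Set (Configuration n) :=
  {C | C.IsInitial ∧ ∃ c, C.IsRotationallySymmetric c ∧ C.NoRobotOn {c} ∧ C.NoMeetingNodeOn {c}}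

/-! ### Robots -/

/-- The orientation of a local coordinate system: a linear automorphism of the grid, that is, one of
the eight ways to choose the directions of the two axes along the grid lines. There is no common
orientation and no common chirality. -/
structure LocalFrame where
  /-- the passage from global to local directions -/
  toLocal : Node ≃+ Node
  /-- it respects the edges of the grid -/
  adj_iff : ∀ u v, gridGraph.Adj (toLocal u) (toLocal v) ↔ gridGraph.Adj u v

/-- What a robot sees, in local coordinates with the robot at the origin: the meeting nodes, and the
exact number of robots on every node (global strong multiplicity detection). -/
structure Snapshot where
  /-- the meeting nodes -/
  meeting : Set Node
  /-- the number of robots on every node -/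
  count : Node → ℕ

/-- A deterministic distributed algorithm. All robots execute the same function, which depends on the
current snapshot only (the robots are anonymous, homogeneous and oblivious). Its value, in local
coordinates, is the origin (stay idle) or a neighbour of the origin. -/
structure Algorithm where
  /-- the computed destination -/
  dest : Snapshot → Node
  /-- the robot stays or goes to an adjacent node -/
  dest_spec : ∀ s, dest s = 0 ∨ gridGraph.Adj 0 (dest s)

/-- The snapshot of the configuration `C` taken by a robot at the node `p` with frame `F`. The node
with local coordinates `u` is the node `p + F.toLocal.symm u` of the grid. -/
def snapshot {n : ℕ} (C : Configuration n) (F : LocalFrame) (p : Node) : Snapshot where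
  meeting := {u | p + F.toLocal.symm u ∈ C.meeting}
  count := fun u => C.count (p + F.toLocal.symm u)

/-- The node of the grid that a robot at `p` with frame `F` computes as its destination. -/
def computedDest {n : ℕ} (A : Algorithm) (C : Configuration n) (F : LocalFrame) (p : Node) : Node :=
  p + F.toLocal.symm (A.dest (snapshot C F p))

/-- An execution of the algorithm `A` from the initial configuration `C` under a fair asynchronous
scheduler, for robots with local frames `F`. A robot alternates between taking a snapshot with
computing a destination, and an instantaneous move to this destination. These events happen at
arbitrary times, so the destination may rest on an outdated snapshot when the robot moves. -/
structure AsyncExecution {n : ℕ} (A : Algorithm) (F : Fin n → LocalFrame)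
    (C : Configuration n) where
  /-- the positions of the robots at every time -/
  pos : ℕ → Fin n → Node
  /-- the destination of the pending move of every robot; `none` if no move is pending -/
  pending : ℕ → Fin n → Option Node
  /-- the execution starts from the configuration `C` -/
  pos_zero : pos 0 = C.robots
  /-- initially no move is pending -/
  pending_zero : ∀ i, pending 0 i = none
  /-- at every time a robot does nothing, or looks and computes, or moves -/
  step : ∀ t i,
    (pos (t + 1) i = pos t i ∧ pending (t + 1) i = pending t i) ∨
    (pending t i = none ∧ pos (t + 1) i = pos t i ∧
      pending (t + 1) i = some (computedDest A ⟨pos t, C.meeting⟩ (F i) (pos t i))) ∨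
    (∃ v, pending t i = some v ∧ pos (t + 1) i = v ∧ pending (t + 1) i = none)
  /-- fairness: every robot completes infinitely many cycles -/
  fair : ∀ i t, ∃ t', t ≤ t' ∧ pending t' i ≠ none ∧ pending (t' + 1) i = none

/-- Gathering over Weber nodes can be solved from the initial configuration `C`: some algorithm, for
all local frames of the robots and in every fair asynchronous execution, brings all robots to one of
the Weber nodes of `C` within finite time, where they remain. -/
def GatheringOverWeberNodesSolvable {n : ℕ} (C : Configuration n) : Prop :=
  ∃ A : Algorithm, ∀ (F : Fin n → LocalFrame) (e : AsyncExecution A F C),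
    ∃ m ∈ C.weberNodes, ∃ T, ∀ t, T ≤ t → ∀ i, e.pos t i = m

/-- The set `U` of the initial configurations from which gathering over Weber nodes cannot be
solved. -/
def unsolvableConfigurations (n : ℕ) : Set (Configuration n) :=
  {C | C.IsInitial ∧ ¬ GatheringOverWeberNodesSolvable C}

end

/-! ### The linear part of a symmetry of the grid -/

/-! Every class is covered by one symmetry-breaking argument. Let `φ` be an involutive symmetry of
the configuration that fixes no robot and no Weber node. It pairs the robots off, and the adversary
gives the two robots of each pair frames exchanged by the linear part of `φ`, then activates all
robots in lockstep. Paired robots always see the same snapshot, so their moves are mirror images and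
the symmetry survives every round (`syncPos_map`). If all robots met at `m`, then `φ m = m`, which
no Weber node satisfies (`mem_unsolvableConfigurations_of_involutive`). A reflection fixes only the
points of its line. A quarter-turn is replaced by its square, a half-turn, which fixes only the
centre. -/

theorem gridGraph_adj_add_left (a u v : Node) :
    gridGraph.Adj (a + u) (a + v) ↔ gridGraph.Adj u v := by
  simp only [gridGraph, SimpleGraph.boxProd_adj, SimpleGraph.hasse_adj, Order.covBy_iff_add_one_eq,
    Prod.fst_add, Prod.snd_add, add_assoc, add_right_inj]

theorem toPlane_injective : Function.Injective toPlane := by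
  intro u v h
  have h1 := congrArg Complex.re h
  have h2 := congrArg Complex.im h
  simp only [toPlane] at h1 h2
  exact Prod.ext (by exact_mod_cast h1) (by exact_mod_cast h2)

theorem toPlane_add (u v : Node) : toPlane (u + v) = toPlane u + toPlane v := by
  apply Complex.ext <;> simp [toPlane]

theorem toPlane_sub (u v : Node) : toPlane (u - v) = toPlane u - toPlane v := by
  apply Complex.ext <;> simp [toPlane]

/-- `φ` is an affine map of `ℤ²`. -/
def GridAut.IsAffine (φ : GridAut) : Prop := ∀ u v, φ (u + v) = φ u + φ v - φ 0

/-- The linear part of an affine involution of the grid. -/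
def GridAut.IsAffine.linearPart {φ : GridAut} (h : φ.IsAffine) (hφ : Function.Involutive φ) :
    Node ≃+ Node :=
  -- Affinity at the pair `φ v - φ 0`, `φ 0`, whose sum is `φ v`: the linear part is its own
  -- inverse.
  have key : ∀ v, φ (φ v - φ 0) - φ 0 = v := fun v => by
    have h1 := h (φ v - φ 0) (φ 0)
    rw [sub_add_cancel, hφ, hφ, add_zero] at h1
    exact h1.symm
  { toFun := fun v => φ v - φ 0
    invFun := fun v => φ v - φ 0
    left_inv := key
    right_inv := key
    map_add' := fun u v => by rw [h u v]; abel }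

theorem GridAut.IsAffine.map_add {φ : GridAut} (h : φ.IsAffine) (hφ : Function.Involutive φ)
    (u v : Node) : φ (u + v) = φ u + h.linearPart hφ v := by
  rw [h u v, add_sub_assoc]; rfl

/-- The linear part of an affine involution of the grid, as the orientation of a coordinate
system. -/
def GridAut.IsAffine.frame {φ : GridAut} (h : φ.IsAffine) (hφ : Function.Involutive φ) :
    LocalFrame where
  toLocal := h.linearPart hφ
  adj_iff u v := by
    rw [← gridGraph_adj_add_left (φ 0), ← h.map_add, ← h.map_add, zero_add, zero_add]
    exact φ.map_adj_iff

/-- The coordinate system with the global orientation. -/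
def LocalFrame.refl : LocalFrame where
  toLocal := AddEquiv.refl Node
  adj_iff _ _ := Iff.rfl

/-! ### Synchronous executions -/

/-- The positions of the robots after every round of the fully synchronous execution. -/
def syncPos {n : ℕ} (A : Algorithm) (F : Fin n → LocalFrame) (C : Configuration n) :
    ℕ → Fin n → Node
  | 0 => C.robots
  | k + 1 => fun i =>
      computedDest A ⟨syncPos A F C k, C.meeting⟩ (F i) (syncPos A F C k i)

/-- The fully synchronous execution: all robots look at even times and move at odd times. -/
def syncExecution {n : ℕ} (A : Algorithm) (F : Fin n → LocalFrame) (C : Configuration n) :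
    AsyncExecution A F C where
  pos t := syncPos A F C (t / 2)
  pending t i := if Even t then none else some (syncPos A F C (t / 2 + 1) i)
  pos_zero := rfl
  pending_zero i := by simp
  step t i := by
    right
    rcases Nat.even_or_odd t with ht | ht
    · have h2 : (t + 1) / 2 = t / 2 := by grind
      refine Or.inl ⟨by simp [ht], by rw [h2], ?_⟩
      simp only [h2, Nat.even_add_one, ht, not_true_eq_false, if_false]
      rfl
    · have h2 : (t + 1) / 2 = t / 2 + 1 := by grind
      have ht' : ¬ Even t := Nat.not_even_iff_odd.mpr ht
      exact Or.inr ⟨syncPos A F C (t / 2 + 1) i, by simp only [ht', if_false], by rw [h2],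
        by simp only [Nat.even_add_one, ht', not_false_eq_true, if_true]⟩
  -- At every odd time a move is pending, and it has been carried out one step later.
  fair i t := ⟨2 * t + 1, by omega, by simp, by simp [Nat.even_add_one]⟩

/-- `σ` matches the robots on `v` with those on `φ v`. Distinct positions are not required, since
robots may collide in later rounds. -/
theorem count_map_eq {n : ℕ} (C : Configuration n) (φ : GridAut) (σ : Equiv.Perm (Fin n))
    (h : ∀ i, C.robots (σ i) = φ (C.robots i)) (v : Node) : C.count (φ v) = C.count v := by
  refine (Finset.card_equiv σ fun i => ?_).symm
  simp [h]

/-- `φ` carries the node with local coordinates `u` in the frame `F` at `p` to the node with the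
same coordinates in `F'` at `φ p`, so both robots take the same snapshot and the algorithm returns
the same local answer. -/
theorem computedDest_map {n : ℕ} (A : Algorithm) (C : Configuration n) {φ : GridAut}
    (h : φ.IsAffine) (hφ : Function.Involutive φ) (hC : C.IsAutomorphism φ) {F F' : LocalFrame}
    (hF : ∀ u, F'.toLocal.symm u = h.linearPart hφ (F.toLocal.symm u)) (p : Node) :
    computedDest A C F' (φ p) = φ (computedDest A C F p) := by
  have hs : snapshot C F' (φ p) = snapshot C F p := by
    simp only [snapshot, hF, ← h.map_add, hC.1 _, hC.2]
  rw [computedDest, hs, hF, ← h.map_add, computedDest]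

theorem syncPos_map {n : ℕ} (A : Algorithm) (C : Configuration n) {φ : GridAut}
    (h : φ.IsAffine) (hφ : Function.Involutive φ) (hM : PreservesNodes φ C.meeting)
    (σ : Equiv.Perm (Fin n)) (hσ : ∀ i, C.robots (σ i) = φ (C.robots i)) {F : Fin n → LocalFrame}
    (hF : ∀ i u, (F (σ i)).toLocal.symm u = h.linearPart hφ ((F i).toLocal.symm u)) (k : ℕ)
    (i : Fin n) : syncPos A F C k (σ i) = φ (syncPos A F C k i) := by
  induction k generalizing i with
  | zero => exact hσ i
  | succ k ih =>
    simp only [syncPos, ih]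
    exact computedDest_map A ⟨syncPos A F C k, C.meeting⟩ h hφ
      ⟨hM, count_map_eq ⟨syncPos A F C k, C.meeting⟩ φ σ ih⟩ (hF i) _

/-! ### Involutive symmetries without fixed robots -/

theorem exists_involution_of_isAutomorphism {n : ℕ} {C : Configuration n} (hC : C.IsInitial)
    {φ : GridAut} (hφ : Function.Involutive φ) (hA : C.IsAutomorphism φ) :
    ∃ σ : Equiv.Perm (Fin n), Function.Involutive σ ∧ ∀ i, C.robots (σ i) = φ (C.robots i) := by
  have hex : ∀ i, ∃ j, C.robots j = φ (C.robots i) := fun i => by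
    have hpos : 0 < C.count (φ (C.robots i)) := by
      rw [hA.2]
      exact Finset.card_pos.mpr ⟨i, by simp⟩
    obtain ⟨j, hj⟩ := Finset.card_pos.mp hpos
    exact ⟨j, (Finset.mem_filter.mp hj).2⟩
  choose σ hσ using hex
  have hinv : Function.Involutive σ := fun i => hC (by rw [hσ, hσ, hφ])
  exact ⟨hinv.toPerm σ, hinv, hσ⟩

/-- In each pair the smaller index gets the global orientation and the larger one its image under
the linear part. A robot fixed by `σ` would force the linear part to be the identity. -/
theorem exists_equivariant_frames {n : ℕ} {φ : GridAut} (h : φ.IsAffine)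
    (hφ : Function.Involutive φ) {σ : Equiv.Perm (Fin n)} (hσ : Function.Involutive σ)
    (hne : ∀ i, σ i ≠ i) : ∃ F : Fin n → LocalFrame,
      ∀ i u, (F (σ i)).toLocal.symm u = h.linearPart hφ ((F i).toLocal.symm u) := by
  refine ⟨fun i => if i < σ i then LocalFrame.refl else h.frame hφ, fun i u => ?_⟩
  rcases lt_or_gt_of_ne (hne i) with hi | hi
  · simp only [hσ i, hi, not_lt_of_gt hi, if_true, if_false]
    exact ((h.linearPart hφ).apply_symm_apply u).symm
  · simp only [hσ i, hi, not_lt_of_gt hi, if_true, if_false]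
    -- The inverse of `linearPart` is defined by the same formula as the map itself.
    rfl

/-- Gathering over Weber nodes cannot be solved from a configuration with an involutive symmetry
that fixes no robot and no Weber node. -/
theorem mem_unsolvableConfigurations_of_involutive {n : ℕ} (hn : 1 ≤ n) {C : Configuration n}
    (hC : C.IsInitial) {φ : GridAut} (h : φ.IsAffine) (hφ : Function.Involutive φ)
    (hA : C.IsAutomorphism φ) (hR : ∀ i, φ (C.robots i) ≠ C.robots i)
    (hW : ∀ m ∈ C.weberNodes, φ m ≠ m) : C ∈ unsolvableConfigurations n := by
  refine ⟨hC, fun ⟨A, hsolve⟩ => ?_⟩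
  obtain ⟨σ, hσ, hσφ⟩ := exists_involution_of_isAutomorphism hC hφ hA
  obtain ⟨F, hF⟩ := exists_equivariant_frames h hφ hσ
    fun i hi => hR i (by rw [← hσφ, hi])
  obtain ⟨m, hm, T, hT⟩ := hsolve F (syncExecution A F C)
  refine hW m hm ?_
  -- By time `T` a robot and its partner both stand on `m`, so equivariance gives `φ m = m`.
  have hmap := syncPos_map A C h hφ hA.1 σ hσφ hF (T / 2) ⟨0, hn⟩
  have h1 : syncPos A F C (T / 2) ⟨0, hn⟩ = m := hT T le_rfl _
  have h2 : syncPos A F C (T / 2) (σ ⟨0, hn⟩) = m := hT T le_rfl _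
  rw [← h1, ← hmap, h2, h1]

/-! ### Reflections -/

theorem IsReflectionIn.involutive {φ : GridAut} {l : AffineSubspace ℝ ℂ}
    (h : IsReflectionIn φ l) : Function.Involutive φ := by
  obtain ⟨_, _, h⟩ := h
  exact fun v => toPlane_injective (by rw [h, h, EuclideanGeometry.reflection_reflection])

theorem IsReflectionIn.isAffine {φ : GridAut} {l : AffineSubspace ℝ ℂ}
    (h : IsReflectionIn φ l) : φ.IsAffine := by
  obtain ⟨_, _, h⟩ := h
  intro u v
  apply toPlane_injective
  have key : ∀ z w : ℂ, EuclideanGeometry.reflection l (z + w) =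
      (EuclideanGeometry.reflection l).linear z + EuclideanGeometry.reflection l w :=
    fun z w => (EuclideanGeometry.reflection l).toAffineEquiv.map_vadd w z
  -- Expresses the linear part of the reflection at `u` through values of the reflection itself.
  have h0 := key (toPlane u) (toPlane 0)
  rw [← toPlane_add, add_zero] at h0
  rw [toPlane_sub, toPlane_add, h, h, h, h, toPlane_add, key, h0]
  abel

theorem IsReflectionIn.mem_of_map_eq {φ : GridAut} {l : AffineSubspace ℝ ℂ}
    (h : IsReflectionIn φ l) {v : Node} (hv : φ v = v) : toPlane v ∈ l := by
  obtain ⟨_, _, h⟩ := h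
  rw [← EuclideanGeometry.reflection_eq_self_iff, ← h, hv]

theorem mem_unsolvableConfigurations_of_isSymmetricIn {n : ℕ} (hn : 1 ≤ n) {C : Configuration n}
    (hC : C.IsInitial) {l : AffineSubspace ℝ ℂ} (hl : C.IsSymmetricIn l) (hR : C.NoRobotOn l)
    (hW : C.NoWeberNodeOn l) : C ∈ unsolvableConfigurations n := by
  obtain ⟨φ, hφ, hA⟩ := hl
  exact mem_unsolvableConfigurations_of_involutive hn hC hφ.isAffine hφ.involutive hA
    (fun i hi => hR i (hφ.mem_of_map_eq hi)) fun m hm hi => hW m hm (hφ.mem_of_map_eq hi)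

/-! ### Rotations -/

theorem Configuration.IsAutomorphism.trans {n : ℕ} {C : Configuration n} {φ ψ : GridAut}
    (hφ : C.IsAutomorphism φ) (hψ : C.IsAutomorphism ψ) : C.IsAutomorphism (φ.trans ψ) :=
  ⟨fun v => (hψ.1 (φ v)).trans (hφ.1 v), fun v => (hψ.2 (φ v)).trans (hφ.2 v)⟩

/-- A configuration with a rotational symmetry has a symmetry by the half-turn about the same
centre. -/
theorem Configuration.IsRotationallySymmetric.exists_halfTurn {n : ℕ} {C : Configuration n} {c : ℂ}
    (h : C.IsRotationallySymmetric c) :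
    ∃ φ : GridAut, C.IsAutomorphism φ ∧ ∀ v, toPlane (φ v) = 2 * c - toPlane v := by
  obtain ⟨φ, ⟨ω, rfl | rfl, hφ⟩, hA⟩ := h
  -- A quarter-turn is not an involution; its square multiplies by `I * I = -1` about the same
  -- centre.
  · refine ⟨φ.trans φ, hA.trans hA, fun v => ?_⟩
    change toPlane (φ (φ v)) = _
    rw [hφ, hφ]
    linear_combination (toPlane v - c) * Complex.I_mul_I
  · exact ⟨φ, hA, fun v => by rw [hφ]; ring⟩

theorem mem_unsolvableConfigurations_of_isRotationallySymmetric {n : ℕ} (hn : 1 ≤ n)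
    {C : Configuration n} (hC : C.IsInitial) {c : ℂ} (hc : C.IsRotationallySymmetric c)
    (hR : C.NoRobotOn {c}) (hW : C.NoWeberNodeOn {c}) : C ∈ unsolvableConfigurations n := by
  obtain ⟨φ, hA, hφ⟩ := hc.exists_halfTurn
  have hfix : ∀ {v}, φ v = v → toPlane v = c := fun {v} hv => by
    have h := hφ v
    rw [hv] at h
    linear_combination h / 2
  refine mem_unsolvableConfigurations_of_involutive hn hC (φ := φ) (fun u v => ?_) (fun v => ?_) hA
    (fun i hi => hR i (hfix hi)) fun m hm hi => hW m hm (hfix hi)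
  · apply toPlane_injective
    have h0 : toPlane 0 = 0 := by apply Complex.ext <;> simp [toPlane]
    rw [toPlane_sub, toPlane_add, hφ, hφ, hφ, hφ, toPlane_add, h0]
    ring
  · apply toPlane_injective
    rw [hφ, hφ]
    ring

/-! ### The impossibility result -/

theorem Configuration.NoMeetingNodeOn.noWeberNodeOn {n : ℕ} {C : Configuration n} {s : Set ℂ}
    (h : C.NoMeetingNodeOn s) : C.NoWeberNodeOn s :=
  fun m hm => h m (Finset.mem_filter.mp hm).1

theorem mainTheorem2 (n : ℕ) (hn : 1 ≤ n) :
    classI3b3 n ∪ classI4b3 n ⊆ unsolvableConfigurations n ∧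
    classI3b4 n ⊆ unsolvableConfigurations n ∧
    singleLineFamily n ∪ rotationalFamily n ⊆ unsolvableConfigurations n := by
  refine ⟨Set.union_subset ?_ ?_, ?_, Set.union_subset ?_ ?_⟩
  · rintro C ⟨l, ⟨hC, _, _, hl⟩, hW, hR⟩
    exact mem_unsolvableConfigurations_of_isSymmetricIn hn hC hl hR hW
  · rintro C ⟨c, ⟨hC, _, _, hc⟩, hM, hR⟩
    exact mem_unsolvableConfigurations_of_isRotationallySymmetric hn hC hc hR hM.noWeberNodeOn
  · rintro C ⟨l, ⟨hC, _, _, hl⟩, hM, hR⟩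
    exact mem_unsolvableConfigurations_of_isSymmetricIn hn hC hl hR hM.noWeberNodeOn
  · rintro C ⟨hC, l, ⟨hl, _⟩, hR, hW⟩
    exact mem_unsolvableConfigurations_of_isSymmetricIn hn hC hl hR hW
  · rintro C ⟨hC, c, hc, hR, hM⟩
    exact mem_unsolvableConfigurations_of_isRotationallySymmetric hn hC hc hR hM.noWeberNodeOn
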